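/- Let $G=(V(G),E(G))$ be a finite simple graph. Assign i.i.d. real random weights $(w_f)_{f\in E(G)}$ to its edges and i.i.d. real random weights $(\nu_v)_{v\in V(G)}$ to its vertices; the two families are independent of each other and may have different distributions. For a subgraph $H\subseteq G$, let $\mathcal M_H$ be a random matching of $H$ (a set of pairwise vertex-disjoint edges of $H$), chosen, given the weights, with probability $$\mu_H(M)=\frac1{Z_H}\exp\Big(\sum_{f\in M}w_f+\sum_{v\in V(H),\,v\notin M}\nu_v\Big),$$ where $v\notin M$ means that $v$ is unmatched in $M$ and $Z_H$ is the normalizing constant; $\langle\cdot\rangle$ denotes expectation with respect to this Gibbs measure, for fixed weights. For an edge $e=(xy)$ of $G$ and $R\ge 1$, let $\mathbb B^e_R$ be the subgraph of $G$ induced by all vertices at graph distance at most $R$ from $x$ or from $y$. Call a random variable $X$ $\varphi$-bounded if $\mathbf P(|X|\ge t)\le\varphi(t)$ for all $t>0$. **Proposition.** Let $\varphi:(0,\infty)\to(0,\infty)$ be a function with $\lim_{s\to\infty}\varphi(s)=0$ and let $D\ge1$ be an integer. There exist constants $c,C>0$, depending only on $\varphi$ and $D$, such that the following holds. Let $G$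 be any finite simple graph of maximum degree at most $D$, with random weights as above such that all edge weights and all vertex weights are $\varphi$-bounded. Then for every edge $e=(xy)\in E(G)$ and every real $R\ge1$ there is an event $A$, belonging to the $\sigma$-algebra generated by the weights $\nu_v$, $v\in V(\mathbb B^e_R)\setminus\{x,y\}$, and $w_f$, $f\in E(\mathbb B^e_R)\setminus\{e\}$, with $$\mathbf P(A)\ge 1-Ce^{-cR},$$ such that on the event $A$ $$\Big|\big\langle\mathbf 1_{\{e\in\mathcal M_G\}}\big\rangle-\big\langle\mathbf 1_{\{e\in\mathcal M_H\}}\big\rangle\Big|\le Ce^{-cR}$$ for every subgraph $H$ with $\mathbb B^e_R\subseteq H\subseteq G$. -/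

import Mathlib

open MeasureTheory ProbabilityTheory Filter Topology

namespace MonomerDimer

variable {V : Type*}

/-- A finite set `M` of edges of `G` is a matching of the subgraph `H`: all its edges belong to
`H`, and distinct edges of `M` have no common vertex. -/
def IsMatchingOf {G : SimpleGraph V} (H : G.Subgraph) (M : Finset G.edgeSet) : Prop :=
  (∀ e ∈ M, (e : Sym2 V) ∈ H.edgeSet) ∧
    ∀ e ∈ M, ∀ f ∈ M, e ≠ f → ∀ v : V, v ∈ (e : Sym2 V) → v ∉ (f : Sym2 V)

open Classical in
/-- The collection of all matchings of the subgraph `H` of `G`. -/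
noncomputable def matchings [Fintype V] {G : SimpleGraph V} (H : G.Subgraph) :
    Finset (Finset G.edgeSet) :=
  Finset.univ.filter fun M => IsMatchingOf H M

open Classical in
/-- The vertices of `H` that are left unmatched by `M`. -/
noncomputable def unmatched [Fintype V] {G : SimpleGraph V} (H : G.Subgraph)
    (M : Finset G.edgeSet) : Finset V :=
  Finset.univ.filter fun x => x ∈ H.verts ∧ ∀ e ∈ M, x ∉ (e : Sym2 V)

/-- The Boltzmann factor `exp (∑_{e ∈ M} w_e + ∑_{x ∉ M} ν_x)` of a matching `M` of `H`
(the inverse temperature is `1`). -/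
noncomputable def boltzmann [Fintype V] {G : SimpleGraph V} (H : G.Subgraph)
    (w : G.edgeSet → ℝ) (ν : V → ℝ) (M : Finset G.edgeSet) : ℝ :=
  Real.exp (∑ e ∈ M, w e + ∑ x ∈ unmatched H M, ν x)

/-- The partition function `Z_H`. -/
noncomputable def partitionFunction [Fintype V] {G : SimpleGraph V} (H : G.Subgraph)
    (w : G.edgeSet → ℝ) (ν : V → ℝ) : ℝ :=
  ∑ M ∈ matchings H, boltzmann H w ν M

/-- The Gibbs probability `μ_H(M)` of a matching `M` of `H`. -/
noncomputable def gibbsProb [Fintype V] {G : SimpleGraph V} (H : G.Subgraph)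
    (w : G.edgeSet → ℝ) (ν : V → ℝ) (M : Finset G.edgeSet) : ℝ :=
  boltzmann H w ν M / partitionFunction H w ν

/-- The Gibbs expectation `⟨f(M_H)⟩` of a function of the random matching of `H`. -/
noncomputable def gibbsExpectation [Fintype V] {G : SimpleGraph V} (H : G.Subgraph)
    (w : G.edgeSet → ℝ) (ν : V → ℝ) (f : Finset G.edgeSet → ℝ) : ℝ :=
  ∑ M ∈ matchings H, f M * gibbsProb H w ν M

/-- `⟨1{e ∈ M_H}⟩`, the Gibbs expectation of the indicator that the edge `e` is in the random
matching of `H`. -/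
noncomputable def edgeMarginal [Fintype V] {G : SimpleGraph V} (H : G.Subgraph)
    (w : G.edgeSet → ℝ) (ν : V → ℝ) (e : G.edgeSet) : ℝ :=
  gibbsExpectation H w ν (Set.indicator {M : Finset G.edgeSet | e ∈ M} 1)

/-- The ball `B_R^e`: the subgraph of `G` induced by all vertices at graph distance at most `R`
from one of the endpoints of `e`. -/
def edgeBall (G : SimpleGraph V) (e : G.edgeSet) (R : ℝ) : G.Subgraph :=
  (⊤ : G.Subgraph).induce
    {v | ∃ u ∈ (e : Sym2 V), G.Reachable u v ∧ (G.dist u v : ℝ) ≤ R}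

/-- The random weights of the disordered monomer-dimer model on `G`: i.i.d. edge weights and
i.i.d. vertex weights (with possibly different distributions), all of them independent. -/
structure DisorderedWeights (G : SimpleGraph V) {Ω : Type*} [MeasurableSpace Ω]
    (P : Measure Ω) where
  edge : G.edgeSet → Ω → ℝ
  vertex : V → Ω → ℝ
  measurable_edge : ∀ e, Measurable (edge e)
  measurable_vertex : ∀ x, Measurable (vertex x)
  indep : iIndepFun (Sum.elim edge vertex) P
  identDistrib_edge : ∀ e f, IdentDistrib (edge e) (edge f) P P
  identDistrib_vertex : ∀ x y, IdentDistrib (vertex x) (vertex y) P P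

/-- The σ-algebra generated by the vertex weights on `U` and the edge weights on `F`. -/
abbrev DisorderedWeights.sigma {G : SimpleGraph V} {Ω : Type*} [MeasurableSpace Ω]
    {P : Measure Ω} (W : DisorderedWeights G P) (U : Set V) (F : Set G.edgeSet) :
    MeasurableSpace Ω :=
  (⨆ x ∈ U, MeasurableSpace.comap (W.vertex x) inferInstance) ⊔
    (⨆ f ∈ F, MeasurableSpace.comap (W.edge f) inferInstance)

/-- A function `(0, ∞) → (0, ∞)` that tends to `0` at infinity; it is given as a function on `ℝ`
whose values outside `(0, ∞)` play no role. -/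
def IsVanishing (φ : ℝ → ℝ) : Prop :=
  (∀ s : ℝ, 0 < s → 0 < φ s) ∧ Tendsto φ atTop (𝓝 0)

/-- `X` is `φ`-bounded: `P(|X| ≥ t) ≤ φ(t)` for all `t > 0`. -/
def IsPhiBounded {Ω : Type*} [MeasurableSpace Ω] (φ : ℝ → ℝ) (X : Ω → ℝ) (P : Measure Ω) :
    Prop :=
  ∀ t : ℝ, 0 < t → P.real {ω | t ≤ |X ω|} ≤ φ t

end MonomerDimer

/-! Give an edge xy of H the activity exp(w_xy - ν_x - ν_y) and the other edges of G activity 0. Up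
to a constant factor, every H then becomes a weighted matching model on the same G. The probability
p_X(v) that v is free in G - X satisfies 1 / p_X(v) = 1 + ∑ a_vu p_{X ∪ {v}}(u), and the marginal of
e = xy is a_e p_∅(x) p_{x}(y).

In the variables log p this recursion never expands the sup norm. At a vertex whose activities sum
to at most K it contracts by K / (1 + K) (`log_one_add_sub_le`). Removed vertices accumulate in X,
so unrolling it follows self-avoiding walks. If each such walk within the ball meets many vertices
with bounded weights around them, the models on G and on H have exponentially close log p at the
ends of e (`abs_log_freeProb_sub_le_pow`). A vertex with bounded weights also bounds log p outright,
which starts the estimate.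

The exceptional event is that some self-avoiding walk of length n from e meets q large weights, with
n proportional to q. Degrees are bounded, so there are only exponentially many walks and sets of q
weights; independence gives each set probability at most φ(t)^q, which wins once t is large
(`measureReal_badEvent_le`). The weights at e and its ends are always counted as bad, so the event
need not look at them. -/

namespace MonomerDimer

/-! ### Weighted matching sums and the recursion for free probabilities -/

section MatchingSums

open Classical in
/-- The matchings of `G` none of whose edges meets the vertex set `X`. -/
noncomputable def matchingsAvoiding {V : Type*} [Fintype V] (G : SimpleGraph V) (X : Set V) :
    Finset (Finset G.edgeSet) :=
  (matchings (⊤ : G.Subgraph)).filter fun M => ∀ f ∈ M, ∀ v ∈ X, v ∉ (f : Sym2 V)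

/-- The weighted sum over the matchings of `G` avoiding `X`, with edge activities `a`. -/
noncomputable def matchSum {V : Type*} [Fintype V] {G : SimpleGraph V} (a : G.edgeSet → ℝ)
    (X : Set V) : ℝ :=
  ∑ M ∈ matchingsAvoiding G X, ∏ f ∈ M, a f

/-- The probability that `v` is unmatched, in the monomer-dimer model on `G - X`. -/
noncomputable def freeProb {V : Type*} [Fintype V] {G : SimpleGraph V} (a : G.edgeSet → ℝ)
    (X : Set V) (v : V) : ℝ :=
  matchSum a (insert v X) / matchSum a X

variable {V : Type*} [Fintype V] {G : SimpleGraph V}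

theorem mem_matchingsAvoiding {X : Set V} {M : Finset G.edgeSet} :
    M ∈ matchingsAvoiding G X ↔
      (∀ e ∈ M, ∀ f ∈ M, e ≠ f → ∀ v : V, v ∈ (e : Sym2 V) → v ∉ (f : Sym2 V)) ∧
        ∀ f ∈ M, ∀ v ∈ X, v ∉ (f : Sym2 V) := by
  classical
  simp only [matchingsAvoiding, matchings, Finset.mem_filter, Finset.mem_univ, true_and,
    IsMatchingOf, SimpleGraph.Subgraph.edgeSet_top, Subtype.coe_prop, implies_true]

theorem empty_mem_matchingsAvoiding (X : Set V) : ∅ ∈ matchingsAvoiding G X := by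
  simp [mem_matchingsAvoiding]

theorem matchSum_pos {a : G.edgeSet → ℝ} (ha : ∀ f, 0 ≤ a f) (X : Set V) : 0 < matchSum a X :=
  lt_of_lt_of_le (by simp) (Finset.single_le_sum
    (f := fun M : Finset G.edgeSet => ∏ f ∈ M, a f)
    (fun M _ => Finset.prod_nonneg fun f _ => ha f) (empty_mem_matchingsAvoiding X))

open Classical in
theorem sum_matchingsAvoiding_mem (a : G.edgeSet → ℝ) {X : Set V} {f : G.edgeSet}
    (hf : ∀ v ∈ X, v ∉ (f : Sym2 V)) :
    ∑ M ∈ (matchingsAvoiding G X).filter (fun M => f ∈ M), ∏ g ∈ M, a g =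
      a f * matchSum a (X ∪ {v | v ∈ (f : Sym2 V)}) := by
  rw [matchSum, Finset.mul_sum]
  have hnot : ∀ M ∈ matchingsAvoiding G (X ∪ {v | v ∈ (f : Sym2 V)}), f ∉ M := by
    intro M hM hfM
    rw [mem_matchingsAvoiding] at hM
    obtain ⟨v, hv⟩ : ∃ v, v ∈ (f : Sym2 V) := ⟨_, Sym2.out_fst_mem _⟩
    exact hM.2 f hfM v (Or.inr hv) hv
  refine Finset.sum_bij' (fun M _ => M.erase f) (fun M _ => insert f M) ?_ ?_ ?_ ?_ ?_
  · intro M hM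
    rw [Finset.mem_filter, mem_matchingsAvoiding] at hM
    obtain ⟨⟨h1, h2⟩, h3⟩ := hM
    rw [mem_matchingsAvoiding]
    refine ⟨fun e he g hg => h1 e (Finset.mem_of_mem_erase he) g (Finset.mem_of_mem_erase hg), ?_⟩
    rintro g hg v (hv | hv)
    · exact h2 g (Finset.mem_of_mem_erase hg) v hv
    · exact h1 f h3 g (Finset.mem_of_mem_erase hg) (Finset.ne_of_mem_erase hg).symm v hv
  · intro M hM
    rw [mem_matchingsAvoiding] at hM
    obtain ⟨h1, h2⟩ := hM
    rw [Finset.mem_filter, mem_matchingsAvoiding]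
    refine ⟨⟨?_, ?_⟩, Finset.mem_insert_self _ _⟩
    · intro e he g hg heg v hve hvg
      rcases Finset.mem_insert.1 he with rfl | he'
      · rcases Finset.mem_insert.1 hg with rfl | hg'
        · exact heg rfl
        · exact h2 g hg' v (Or.inr hve) hvg
      · rcases Finset.mem_insert.1 hg with rfl | hg'
        · exact h2 e he' v (Or.inr hvg) hve
        · exact h1 e he' g hg' heg v hve hvg
    · intro g hg v hv
      rcases Finset.mem_insert.1 hg with rfl | hg'
      · exact hf v hv
      · exact h2 g hg' v (Or.inl hv)
  · intro M hM
    exact Finset.insert_erase (Finset.mem_filter.1 hM).2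
  · intro M hM
    exact Finset.erase_insert (hnot M hM)
  · intro M hM
    exact (Finset.mul_prod_erase M a (Finset.mem_filter.1 hM).2).symm

open Classical in
/-- The edges at `v` that avoid `X`. -/
noncomputable def edgesAt (G : SimpleGraph V) (X : Set V) (v : V) : Finset G.edgeSet :=
  Finset.univ.filter fun f => v ∈ (f : Sym2 V) ∧ ∀ u ∈ X, u ∉ (f : Sym2 V)

theorem mem_edgesAt {X : Set V} {v : V} {f : G.edgeSet} :
    f ∈ edgesAt G X v ↔ v ∈ (f : Sym2 V) ∧ ∀ u ∈ X, u ∉ (f : Sym2 V) := by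
  simp [edgesAt]

/-- In a matching, either v is uncovered or exactly one edge covers it; removing that edge leaves a
matching that avoids both its ends. -/
theorem matchSum_eq_add (a : G.edgeSet → ℝ) (X : Set V) (v : V) :
    matchSum a X = matchSum a (insert v X) +
      ∑ f ∈ edgesAt G X v, a f * matchSum a (X ∪ {u | u ∈ (f : Sym2 V)}) := by
  classical
  rw [matchSum, ← Finset.sum_filter_not_add_sum_filter _
    (fun M : Finset G.edgeSet => ∃ f ∈ M, v ∈ (f : Sym2 V))]
  congr 1
  · rw [matchSum]
    refine Finset.sum_congr ?_ fun _ _ => rfl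
    ext M
    simp only [Finset.mem_filter, mem_matchingsAvoiding, Set.mem_insert_iff, forall_eq_or_imp,
      not_exists, not_and]
    constructor
    · rintro ⟨⟨h1, h2⟩, h3⟩
      exact ⟨h1, fun f hf => ⟨h3 f hf, h2 f hf⟩⟩
    · rintro ⟨h1, h2⟩
      exact ⟨⟨h1, fun f hf => (h2 f hf).2⟩, fun f hf => (h2 f hf).1⟩
  · have : (matchingsAvoiding G X).filter (fun M : Finset G.edgeSet => ∃ f ∈ M, v ∈ (f : Sym2 V)) =
        (edgesAt G X v).biUnion fun f =>
          (matchingsAvoiding G X).filter (fun M : Finset G.edgeSet => f ∈ M) := by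
      ext M
      simp only [Finset.mem_filter, Finset.mem_biUnion, mem_edgesAt]
      constructor
      · rintro ⟨hM, f, hf, hv⟩
        exact ⟨f, ⟨hv, (mem_matchingsAvoiding.1 hM).2 f hf⟩, hM, hf⟩
      · rintro ⟨f, ⟨hv, -⟩, hM, hf⟩
        exact ⟨hM, f, hf, hv⟩
    rw [this, Finset.sum_biUnion]
    · exact Finset.sum_congr rfl fun f hf => sum_matchingsAvoiding_mem a (mem_edgesAt.1 hf).2
    · intro f hf g hg hfg
      rw [Function.onFun, Finset.disjoint_left]
      intro M hM hM'
      rw [Finset.mem_filter] at hM hM'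
      exact (mem_matchingsAvoiding.1 hM.1).1 f hM.2 g hM'.2 hfg v
        (mem_edgesAt.1 hf).1 (mem_edgesAt.1 hg).1

variable {a : G.edgeSet → ℝ}

theorem freeProb_pos (ha : ∀ f, 0 ≤ a f) (X : Set V) (v : V) : 0 < freeProb a X v :=
  div_pos (matchSum_pos ha _) (matchSum_pos ha _)

theorem freeProb_le_one (ha : ∀ f, 0 ≤ a f) (X : Set V) (v : V) : freeProb a X v ≤ 1 := by
  rw [freeProb, div_le_one (matchSum_pos ha _), matchSum_eq_add a X v]
  exact le_add_of_nonneg_right (Finset.sum_nonneg fun f _ =>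
    mul_nonneg (ha f) (matchSum_pos ha _).le)

/-- The sum `∑ a_{vu} p_u` over the neighbours `u` of `v` in `G - X`, where `p_u` is the
probability that `u` is free in `G - X - v`. -/
noncomputable def branchSum (a : G.edgeSet → ℝ) (X : Set V) (v : V) : ℝ :=
  ∑ f ∈ edgesAt G X v,
    a f * (matchSum a (X ∪ {u | u ∈ (f : Sym2 V)}) / matchSum a (insert v X))

/-- This is `matchSum_eq_add` divided by the matching sum with v removed. -/
theorem log_freeProb (ha : ∀ f, 0 ≤ a f) (X : Set V) (v : V) :
    Real.log (freeProb a X v) = -Real.log (1 + branchSum a X v) := by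
  rw [← Real.log_inv]
  congr 1
  have h1 := matchSum_pos ha (insert v X)
  have h2 : 1 + branchSum a X v = matchSum a X / matchSum a (insert v X) := by
    rw [matchSum_eq_add a X v, add_div, div_self h1.ne', branchSum, Finset.sum_div]
    simp only [mul_div_assoc]
  rw [h2, inv_div, freeProb]

/-- Deleting both ends of an edge vu amounts to deleting v and then u, so each quotient in
`branchSum` is a free probability at u in G - X - v. -/
theorem exists_other_of_mem_edgesAt {X : Set V} {v : V} {f : G.edgeSet}
    (hf : f ∈ edgesAt G X v) :
    ∃ u, G.Adj v u ∧ u ∉ insert v X ∧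
      X ∪ {u | u ∈ (f : Sym2 V)} = insert u (insert v X) := by
  obtain ⟨hv, hX⟩ := mem_edgesAt.1 hf
  obtain ⟨f, hfE⟩ := f
  obtain ⟨u, rfl⟩ := Sym2.mem_iff_exists.1 hv
  have hadj : G.Adj v u := hfE
  refine ⟨u, hadj, ?_, ?_⟩
  · rintro (h | h)
    · exact hadj.ne h.symm
    · exact hX u h (by simp)
  · ext z
    simp only [Set.mem_union, Set.mem_ofPred_eq, Sym2.mem_iff, Set.mem_insert_iff]
    tauto

theorem branchSum_nonneg (ha : ∀ f, 0 ≤ a f) (X : Set V) (v : V) : 0 ≤ branchSum a X v :=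
  Finset.sum_nonneg fun f _ => mul_nonneg (ha f)
    (div_nonneg (matchSum_pos ha _).le (matchSum_pos ha _).le)

theorem branchSum_le (ha : ∀ f, 0 ≤ a f) (X : Set V) (v : V) :
    branchSum a X v ≤ ∑ f ∈ edgesAt G ∅ v, a f := by
  refine (Finset.sum_le_sum (g := a) fun f hf => ?_).trans
    (Finset.sum_le_sum_of_subset_of_nonneg ?_ fun f _ _ => ha f)
  · obtain ⟨u, -, -, hu⟩ := exists_other_of_mem_edgesAt hf
    rw [hu]
    exact mul_le_of_le_one_right (ha f) (freeProb_le_one ha _ u)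
  · intro f hf
    rw [mem_edgesAt] at hf ⊢
    exact ⟨hf.1, by simp⟩

theorem branchSum_le_exp_mul {b : G.edgeSet → ℝ} (ha : ∀ f, 0 ≤ a f) (hb : ∀ f, 0 ≤ b f)
    {X : Set V} {v : V} (hab : ∀ f : G.edgeSet, v ∈ (f : Sym2 V) → a f = b f) {δ : ℝ}
    (h : ∀ u, G.Adj v u → u ∉ insert v X →
      |Real.log (freeProb a (insert v X) u) - Real.log (freeProb b (insert v X) u)| ≤ δ) :
    branchSum a X v ≤ Real.exp δ * branchSum b X v := by
  rw [branchSum, branchSum, Finset.mul_sum]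
  refine Finset.sum_le_sum fun f hf => ?_
  obtain ⟨u, h1, h2, hu⟩ := exists_other_of_mem_edgesAt hf
  rw [hu, hab f (mem_edgesAt.1 hf).1, mul_left_comm]
  refine mul_le_mul_of_nonneg_left ?_ (hb f)
  change freeProb a (insert v X) u ≤ Real.exp δ * freeProb b (insert v X) u
  have hpa := freeProb_pos ha (insert v X) u
  have hpb := freeProb_pos hb (insert v X) u
  rw [← Real.log_le_log_iff hpa (mul_pos (Real.exp_pos _) hpb),
    Real.log_mul (Real.exp_pos _).ne' hpb.ne', Real.log_exp]
  linarith [(abs_le.1 (h u h1 h2)).2]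

end MatchingSums

/-! ### Contraction of the recursion in logarithmic coordinates -/

/-- The source of the contraction: log(1 + T) has derivative T / (1 + T) ≤ K / (1 + K) with respect
to log T. The proof is derivative-free, by concavity of log. -/
theorem log_one_add_sub_le {S T K δ : ℝ} (hS : 0 ≤ S) (hT : 0 ≤ T) (hTK : T ≤ K) (hδ : 0 ≤ δ)
    (hTS : T ≤ Real.exp δ * S) :
    Real.log (1 + T) - Real.log (1 + S) ≤ K / (1 + K) * δ := by
  have hK : 0 ≤ K := hT.trans hTK
  rcases le_or_gt T S with h | h
  · have h1 : Real.log (1 + T) ≤ Real.log (1 + S) := Real.log_le_log (by linarith) (by linarith)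
    have h2 : 0 ≤ K / (1 + K) * δ := by positivity
    linarith
  · have hT0 : 0 < T := hS.trans_lt h
    have hS0 : 0 < S := by
      by_contra hn
      have : S = 0 := le_antisymm (not_lt.1 hn) hS
      rw [this, mul_zero] at hTS
      linarith
    -- The points 1 and S/T with weights 1/(1+T) and T/(1+T) average to (1+S)/(1+T).
    have hconc := strictConcaveOn_log_Ioi.concaveOn.2
      (Set.mem_Ioi.2 one_pos) (Set.mem_Ioi.2 (div_pos hS0 hT0))
      (show 0 ≤ 1 / (1 + T) by positivity) (show 0 ≤ T / (1 + T) by positivity) (by field_simp)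
    simp only [smul_eq_mul, Real.log_one, mul_zero, zero_add] at hconc
    have h3 : 1 / (1 + T) * 1 + T / (1 + T) * (S / T) = (1 + S) / (1 + T) := by
      field_simp
    rw [h3, Real.log_div hS0.ne' hT0.ne', Real.log_div (by positivity) (by positivity)] at hconc
    have h4 : Real.log T - Real.log S ≤ δ := by
      have := Real.log_le_log hT0 hTS
      rw [Real.log_mul (Real.exp_pos _).ne' hS0.ne', Real.log_exp] at this
      linarith
    have h5 : T / (1 + T) ≤ K / (1 + K) := by
      rw [div_le_div_iff₀ (by positivity) (by positivity)]
      nlinarith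
    calc Real.log (1 + T) - Real.log (1 + S) ≤ T / (1 + T) * (Real.log T - Real.log S) := by
          linarith
      _ ≤ T / (1 + T) * δ := mul_le_mul_of_nonneg_left h4 (by positivity)
      _ ≤ K / (1 + K) * δ := mul_le_mul_of_nonneg_right h5 hδ

section Contraction

variable {V : Type*} [Fintype V] {G : SimpleGraph V} {a b : G.edgeSet → ℝ}

theorem abs_log_freeProb_sub_le_mul (ha : ∀ f, 0 ≤ a f) (hb : ∀ f, 0 ≤ b f) {X : Set V} {v : V}
    (hab : ∀ f : G.edgeSet, v ∈ (f : Sym2 V) → a f = b f) {δ K : ℝ} (hδ : 0 ≤ δ)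
    (hK : ∑ f ∈ edgesAt G ∅ v, a f ≤ K)
    (h : ∀ u, G.Adj v u → u ∉ insert v X →
      |Real.log (freeProb a (insert v X) u) - Real.log (freeProb b (insert v X) u)| ≤ δ) :
    |Real.log (freeProb a X v) - Real.log (freeProb b X v)| ≤ K / (1 + K) * δ := by
  have hK' : ∑ f ∈ edgesAt G ∅ v, b f ≤ K := by
    rwa [← Finset.sum_congr rfl fun f hf => hab f (mem_edgesAt.1 hf).1]
  have hSa := branchSum_nonneg ha X v
  have hSb := branchSum_nonneg hb X v
  have h1 := log_one_add_sub_le hSb hSa ((branchSum_le ha X v).trans hK) hδ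
    (branchSum_le_exp_mul ha hb hab h)
  have h2 := log_one_add_sub_le hSa hSb ((branchSum_le hb X v).trans hK') hδ
    (branchSum_le_exp_mul hb ha (fun f hf => (hab f hf).symm) fun u h1 h2 => by
      rw [abs_sub_comm]; exact h u h1 h2)
  rw [log_freeProb ha, log_freeProb hb, abs_le]
  constructor <;> linarith

/-- For vertices with uncontrolled weights: K may be the activity sum itself, and K / (1 + K) ≤ 1
whatever its size. -/
theorem abs_log_freeProb_sub_le (ha : ∀ f, 0 ≤ a f) (hb : ∀ f, 0 ≤ b f) {X : Set V} {v : V}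
    (hab : ∀ f : G.edgeSet, v ∈ (f : Sym2 V) → a f = b f) {δ : ℝ} (hδ : 0 ≤ δ)
    (h : ∀ u, G.Adj v u → u ∉ insert v X →
      |Real.log (freeProb a (insert v X) u) - Real.log (freeProb b (insert v X) u)| ≤ δ) :
    |Real.log (freeProb a X v) - Real.log (freeProb b X v)| ≤ δ := by
  have hK : 0 ≤ ∑ f ∈ edgesAt G ∅ v, a f := Finset.sum_nonneg fun f _ => ha f
  refine (abs_log_freeProb_sub_le_mul ha hb hab hδ le_rfl h).trans
    (mul_le_of_le_one_left hδ ?_)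
  rw [div_le_one (by linarith)]
  linarith

/-- Both logarithms lie in [-log(1 + K), 0], so nothing need be known about the neighbours. This
bound ends the unrolling. -/
theorem abs_log_freeProb_sub_le_log (ha : ∀ f, 0 ≤ a f) (hb : ∀ f, 0 ≤ b f) {X : Set V} {v : V}
    (hab : ∀ f : G.edgeSet, v ∈ (f : Sym2 V) → a f = b f) {K : ℝ}
    (hK : ∑ f ∈ edgesAt G ∅ v, a f ≤ K) :
    |Real.log (freeProb a X v) - Real.log (freeProb b X v)| ≤ Real.log (1 + K) := by
  have hK' : ∑ f ∈ edgesAt G ∅ v, b f ≤ K := by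
    rwa [← Finset.sum_congr rfl fun f hf => hab f (mem_edgesAt.1 hf).1]
  have hSa := branchSum_nonneg ha X v
  have hSb := branchSum_nonneg hb X v
  have h1 := Real.log_le_log (by linarith) (add_le_add_right ((branchSum_le ha X v).trans hK) 1)
  have h2 := Real.log_le_log (by linarith) (add_le_add_right ((branchSum_le hb X v).trans hK') 1)
  have h3 := Real.log_nonneg (le_add_of_nonneg_right hSa)
  have h4 := Real.log_nonneg (le_add_of_nonneg_right hSb)
  rw [log_freeProb ha, log_freeProb hb, abs_le]
  constructor <;> linarith

end Contraction

/-! ### Unrolling the recursion along self-avoiding walks -/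

section Walks

variable {V : Type*} [Fintype V]

open Classical in
/-- The vertex lists of the walks of length `n` in `G` that start at `v`. -/
noncomputable def walksFrom (G : SimpleGraph V) : ℕ → V → Finset (List V)
  | 0, v => {[v]}
  | n + 1, v => (Finset.univ.filter (G.Adj v)).biUnion fun u =>
      (walksFrom G n u).image (List.cons v)

variable {G : SimpleGraph V}

theorem mem_walksFrom_succ {n : ℕ} {v : V} {l : List V} :
    l ∈ walksFrom G (n + 1) v ↔ ∃ u, G.Adj v u ∧ ∃ l' ∈ walksFrom G n u, v :: l' = l := by
  classical
  simp [walksFrom]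

theorem length_of_mem_walksFrom {n : ℕ} {v : V} {l : List V} (hl : l ∈ walksFrom G n v) :
    l.length = n + 1 := by
  induction n generalizing v l with
  | zero => simp_all [walksFrom]
  | succ n ih =>
    obtain ⟨u, -, l', hl', rfl⟩ := mem_walksFrom_succ.1 hl
    simp [ih hl']

theorem exists_walk_of_mem_walksFrom {n : ℕ} {v : V} {l : List V} (hl : l ∈ walksFrom G n v)
    {z : V} (hz : z ∈ l) : ∃ p : G.Walk v z, p.length ≤ n := by
  induction n generalizing v l with
  | zero =>
    obtain rfl : z = v := by simp_all [walksFrom]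
    exact ⟨.nil, le_rfl⟩
  | succ n ih =>
    obtain ⟨u, hu, l', hl', rfl⟩ := mem_walksFrom_succ.1 hl
    rcases List.mem_cons.1 hz with rfl | hz'
    · exact ⟨.nil, Nat.zero_le _⟩
    · obtain ⟨p, hp⟩ := ih hl' hz'
      exact ⟨.cons hu p, by simpa using hp⟩

open Classical in
theorem card_walksFrom_le {D : ℕ} (hD : ∀ v, (Finset.univ.filter (G.Adj v)).card ≤ D) (n : ℕ)
    (v : V) : (walksFrom G n v).card ≤ D ^ n := by
  induction n generalizing v with
  | zero => simp [walksFrom]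
  | succ n ih =>
    rw [walksFrom, pow_succ']
    refine (Finset.card_biUnion_le_card_mul _ _ (D ^ n) fun u _ =>
      Finset.card_image_le.trans (ih u)).trans (Nat.mul_le_mul_right _ (hD v))

/-- Of the m + 1 good vertices on each walk, m contract and the last supplies the a priori bound
log(1 + K). Only walks that are self-avoiding and avoid X matter, since each step moves the current
vertex into X. The index j records the distance travelled, so the two activities need to agree only
up to distance N. -/
theorem abs_log_freeProb_sub_le_pow {a b : G.edgeSet → ℝ} (ha : ∀ f, 0 ≤ a f)
    (hb : ∀ f, 0 ≤ b f) {K : ℝ} (hK : 0 ≤ K) {near : ℕ → V → Prop} {N : ℕ}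
    (hnear : ∀ j v u, near j v → G.Adj v u → near (j + 1) u)
    (hab : ∀ j ≤ N, ∀ v, near j v → ∀ f : G.edgeSet, v ∈ (f : Sym2 V) → a f = b f)
    (good : V → Bool)
    (hgood : ∀ j ≤ N, ∀ v, near j v → good v = true → ∑ f ∈ edgesAt G ∅ v, a f ≤ K)
    (n j m : ℕ) (hjn : j + n ≤ N) (X : Set V) (v : V) (hv : v ∉ X) (hjv : near j v)
    (hm : ∀ l ∈ walksFrom G n v, l.Nodup → (∀ u ∈ l, u ∉ X) → m + 1 ≤ l.countP good) :
    |Real.log (freeProb a X v) - Real.log (freeProb b X v)| ≤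
      (K / (1 + K)) ^ m * Real.log (1 + K) := by
  have hlog : 0 ≤ Real.log (1 + K) := Real.log_nonneg (by linarith)
  have hκ : 0 ≤ K / (1 + K) := by positivity
  induction n generalizing j m X v with
  | zero =>
    have := hm [v] (by simp [walksFrom]) (by simp) (by simpa using hv)
    cases hg : good v with
    | false => simp [hg] at this
    | true =>
      obtain rfl : m = 0 := by simpa [hg] using this
      simpa using abs_log_freeProb_sub_le_log ha hb (hab j (by omega) v hjv)
        (hgood j (by omega) v hjv hg)
  -- Stepping past v uses up one required good vertex exactly when v is good; `m'` covers both
  -- cases.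
  | succ n ih =>
    have hstep : ∀ m' : ℕ, (m' + if good v then 1 else 0) ≤ m → ∀ u, G.Adj v u →
        u ∉ insert v X →
        |Real.log (freeProb a (insert v X) u) - Real.log (freeProb b (insert v X) u)| ≤
          (K / (1 + K)) ^ m' * Real.log (1 + K) := by
      intro m' hm' u hu huX
      refine ih (j + 1) m' (by omega) _ u huX (hnear _ _ _ hjv hu) fun l hl hnd hlX => ?_
      have := hm (v :: l) (mem_walksFrom_succ.2 ⟨u, hu, l, hl, rfl⟩)
        (List.nodup_cons.2 ⟨fun h => hlX v h (Set.mem_insert _ _), hnd⟩) (by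
          intro w hw
          rcases List.mem_cons.1 hw with rfl | hw
          · exact hv
          · exact fun h => hlX w hw (Set.mem_insert_of_mem _ h))
      rw [List.countP_cons] at this
      omega
    have hab' := hab j (by omega) v hjv
    cases hg : good v with
    | false =>
      exact abs_log_freeProb_sub_le ha hb hab' (by positivity) (hstep m (by simp [hg]))
    | true =>
      have hgv := hgood j (by omega) v hjv hg
      cases m with
      | zero => simpa using abs_log_freeProb_sub_le_log ha hb hab' hgv
      | succ m =>
        rw [pow_succ', mul_assoc]
        exact abs_log_freeProb_sub_le_mul ha hb hab' (by positivity) hgv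
          (hstep m (by simp [hg]))

end Walks

/-! ### From Gibbs marginals to free probabilities -/

section Marginals

variable {V : Type*} [Fintype V] {G : SimpleGraph V}

open Classical in
/-- The activity `exp (w_f - ν_x - ν_y)` of an edge `f = xy` of `H`; edges outside `H` have
activity zero. -/
noncomputable def activity (H : G.Subgraph) (w : G.edgeSet → ℝ) (ν : V → ℝ)
    (f : G.edgeSet) : ℝ :=
  if (f : Sym2 V) ∈ H.edgeSet then
    Real.exp (w f - ∑ x ∈ Finset.univ.filter (fun x => x ∈ (f : Sym2 V)), ν x) else 0

theorem activity_nonneg (H : G.Subgraph) (w : G.edgeSet → ℝ) (ν : V → ℝ) (f : G.edgeSet) :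
    0 ≤ activity H w ν f := by
  unfold activity
  split_ifs <;> positivity

-- The vertex weights of unmatched vertices are those of all vertices of H minus those of covered
-- ones, and each covered vertex belongs to a single edge of M.
open Classical in
theorem boltzmann_eq {H : G.Subgraph} {M : Finset G.edgeSet} (hM : IsMatchingOf H M)
    (w : G.edgeSet → ℝ) (ν : V → ℝ) :
    boltzmann H w ν M = Real.exp (∑ x ∈ Finset.univ.filter (fun x => x ∈ H.verts), ν x) *
      ∏ f ∈ M, activity H w ν f := by
  have h1 : ∏ f ∈ M, activity H w ν f = Real.exp (∑ f ∈ M,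
      (w f - ∑ x ∈ Finset.univ.filter (fun x => x ∈ (f : Sym2 V)), ν x)) := by
    rw [Real.exp_sum]
    exact Finset.prod_congr rfl fun f hf => if_pos (hM.1 f hf)
  have h2 : ∑ f ∈ M, ∑ x ∈ Finset.univ.filter (fun x => x ∈ (f : Sym2 V)), ν x =
      ∑ x ∈ Finset.univ.filter (fun x => x ∈ H.verts ∧ ¬ ∀ f ∈ M, x ∉ (f : Sym2 V)), ν x := by
    rw [← Finset.sum_biUnion]
    · refine Finset.sum_congr ?_ fun _ _ => rfl
      ext x
      simp only [Finset.mem_biUnion, Finset.mem_filter, Finset.mem_univ, true_and, not_forall,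
        not_not]
      constructor
      · rintro ⟨f, hf, hx⟩
        exact ⟨H.mem_verts_of_mem_edge (hM.1 f hf) hx, f, hf, hx⟩
      · rintro ⟨-, f, hf, hx⟩
        exact ⟨f, hf, hx⟩
    · intro f hf g hg hfg
      rw [Function.onFun, Finset.disjoint_left]
      intro x hx hx'
      exact hM.2 f hf g hg hfg x (Finset.mem_filter.1 hx).2 (Finset.mem_filter.1 hx').2
  have h3 : ∑ x ∈ Finset.univ.filter (fun x => x ∈ H.verts), ν x = ∑ x ∈ unmatched H M, ν x +
      ∑ x ∈ Finset.univ.filter (fun x => x ∈ H.verts ∧ ¬ ∀ f ∈ M, x ∉ (f : Sym2 V)), ν x := by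
    rw [← Finset.sum_filter_add_sum_filter_not _ (fun x => ∀ f ∈ M, x ∉ (f : Sym2 V)),
      Finset.filter_filter, Finset.filter_filter, unmatched]
  rw [h1, ← Real.exp_add, boltzmann, Finset.sum_sub_distrib, h2, h3]
  congr 1
  ring

-- A matching of G using an edge outside H has weight zero, so sums over matchings of H extend to
-- all matchings of G.
open Classical in
theorem sum_matchings_mul_boltzmann (H : G.Subgraph) (w : G.edgeSet → ℝ) (ν : V → ℝ)
    (F : Finset G.edgeSet → ℝ) :
    ∑ M ∈ matchings H, F M * boltzmann H w ν M =
      Real.exp (∑ x ∈ Finset.univ.filter (fun x => x ∈ H.verts), ν x) *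
        ∑ M ∈ matchingsAvoiding G ∅, F M * ∏ f ∈ M, activity H w ν f := by
  rw [Finset.mul_sum]
  have hsub : matchings H ⊆ matchingsAvoiding G ∅ := by
    intro M hM
    rw [mem_matchingsAvoiding]
    exact ⟨(Finset.mem_filter.1 hM).2.2, by simp⟩
  rw [← Finset.sum_subset hsub]
  · refine Finset.sum_congr rfl fun M hM => ?_
    rw [boltzmann_eq (Finset.mem_filter.1 hM).2, mul_left_comm]
  · intro M hM hMH
    have : ∃ f ∈ M, (f : Sym2 V) ∉ H.edgeSet := by
      by_contra! hcon
      exact hMH (Finset.mem_filter.2 ⟨Finset.mem_univ _, hcon, (mem_matchingsAvoiding.1 hM).1⟩)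
    obtain ⟨f, hf, hfH⟩ := this
    rw [Finset.prod_eq_zero hf (if_neg hfH), mul_zero, mul_zero]

theorem edgeMarginal_eq (H : G.Subgraph) (w : G.edgeSet → ℝ) (ν : V → ℝ) (e : G.edgeSet) :
    edgeMarginal H w ν e = activity H w ν e *
      matchSum (activity H w ν) {v | v ∈ (e : Sym2 V)} / matchSum (activity H w ν) ∅ := by
  classical
  have hZ := sum_matchings_mul_boltzmann H w ν 1
  have hN := sum_matchings_mul_boltzmann H w ν
    (Set.indicator {M : Finset G.edgeSet | e ∈ M} 1)
  simp only [Pi.one_apply, one_mul] at hZ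
  have h1 := sum_matchingsAvoiding_mem (activity H w ν) (X := ∅) (f := e) (by simp)
  rw [Set.empty_union, Finset.sum_filter] at h1
  rw [edgeMarginal, gibbsExpectation]
  simp only [gibbsProb, ← mul_div_assoc]
  rw [← Finset.sum_div, partitionFunction, hN, hZ, mul_div_mul_left _ _ (Real.exp_pos _).ne', ← h1,
    matchSum]
  congr 1
  refine Finset.sum_congr rfl fun M _ => ?_
  simp [Set.indicator_apply]

theorem edgeMarginal_eq_mul (H : G.Subgraph) (w : G.edgeSet → ℝ) (ν : V → ℝ) {x y : V}
    (h : s(x, y) ∈ G.edgeSet) :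
    edgeMarginal H w ν ⟨s(x, y), h⟩ = activity H w ν ⟨s(x, y), h⟩ *
      (freeProb (activity H w ν) ∅ x * freeProb (activity H w ν) {x} y) := by
  have h1 : ({v | v ∈ s(x, y)} : Set V) = insert y {x} := by
    ext z
    simp [or_comm]
  rw [edgeMarginal_eq, freeProb, freeProb, insert_empty_eq, h1, mul_div_assoc]
  have := (matchSum_pos (activity_nonneg H w ν) {x}).ne'
  field_simp

theorem edgeMarginal_le_one (H : G.Subgraph) (w : G.edgeSet → ℝ) (ν : V → ℝ) (e : G.edgeSet) :
    edgeMarginal H w ν e ≤ 1 := by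
  have ha := activity_nonneg H w ν
  obtain ⟨v, hv⟩ : ∃ v, v ∈ (e : Sym2 V) := ⟨_, Sym2.out_fst_mem _⟩
  rw [edgeMarginal_eq, div_le_one (matchSum_pos ha _), matchSum_eq_add _ ∅ v]
  have h1 := Finset.single_le_sum (f := fun f : G.edgeSet =>
      activity H w ν f * matchSum (activity H w ν) (∅ ∪ {u | u ∈ (f : Sym2 V)}))
    (fun f _ => mul_nonneg (ha f) (matchSum_pos ha _).le) (mem_edgesAt.2 ⟨hv, by simp⟩ :
      e ∈ edgesAt G ∅ v)
  simp only [Set.empty_union] at h1 ⊢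
  linarith [matchSum_pos ha (insert v ∅)]

/-- On (0, 1] the logarithm has slope at least 1. -/
theorem abs_sub_le_abs_log_sub {p q : ℝ} (hp : 0 < p) (hp1 : p ≤ 1) (hq : 0 < q) (hq1 : q ≤ 1) :
    |p - q| ≤ |Real.log p - Real.log q| := by
  wlog h : q ≤ p generalizing p q
  · rw [abs_sub_comm, abs_sub_comm (Real.log p)]
    exact this hq hq1 hp hp1 (le_of_not_ge h)
  rw [abs_of_nonneg (sub_nonneg.2 h), abs_of_nonneg (sub_nonneg.2 (Real.log_le_log hq h)),
    ← Real.log_div hp.ne' hq.ne']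
  have h1 := Real.one_sub_inv_le_log_of_pos (div_pos hp hq)
  refine le_trans ?_ h1
  rw [inv_div, ← sub_nonneg]
  have : 1 - q / p - (p - q) = (p - q) * (1 - p) / p := by
    field_simp
  rw [this]
  exact div_nonneg (mul_nonneg (by linarith) (by linarith)) hp.le

/-- Passing to logarithms of the whole marginals, which are at most 1, cancels the common activity
of e. Hence no bound on the weights at e is needed. -/
theorem abs_edgeMarginal_sub_le {H H' : G.Subgraph} {w : G.edgeSet → ℝ} {ν : V → ℝ} {x y : V}
    (h : s(x, y) ∈ G.edgeSet) (hH : s(x, y) ∈ H.edgeSet) (hH' : s(x, y) ∈ H'.edgeSet) :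
    |edgeMarginal H w ν ⟨s(x, y), h⟩ - edgeMarginal H' w ν ⟨s(x, y), h⟩| ≤
      |Real.log (freeProb (activity H w ν) ∅ x) - Real.log (freeProb (activity H' w ν) ∅ x)| +
      |Real.log (freeProb (activity H w ν) {x} y) -
        Real.log (freeProb (activity H' w ν) {x} y)| := by
  have hl := edgeMarginal_le_one H w ν ⟨s(x, y), h⟩
  have hl' := edgeMarginal_le_one H' w ν ⟨s(x, y), h⟩
  have hact : activity H' w ν ⟨s(x, y), h⟩ = activity H w ν ⟨s(x, y), h⟩ := by
    simp [activity, hH, hH']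
  have hpos : 0 < activity H w ν ⟨s(x, y), h⟩ := by
    simp only [activity, hH, if_true]
    positivity
  have h1 := freeProb_pos (activity_nonneg H w ν) ∅ x
  have h2 := freeProb_pos (activity_nonneg H w ν) {x} y
  have h3 := freeProb_pos (activity_nonneg H' w ν) ∅ x
  have h4 := freeProb_pos (activity_nonneg H' w ν) {x} y
  rw [edgeMarginal_eq_mul] at hl
  rw [edgeMarginal_eq_mul, hact] at hl'
  rw [edgeMarginal_eq_mul, edgeMarginal_eq_mul, hact]
  generalize freeProb (activity H w ν) ∅ x = p at *
  generalize freeProb (activity H w ν) {x} y = r at *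
  generalize freeProb (activity H' w ν) ∅ x = p' at *
  generalize freeProb (activity H' w ν) {x} y = r' at *
  refine (abs_sub_le_abs_log_sub (by positivity) hl (by positivity) hl').trans ?_
  rw [Real.log_mul hpos.ne' (by positivity), Real.log_mul hpos.ne' (by positivity),
    Real.log_mul h1.ne' h2.ne', Real.log_mul h3.ne' h4.ne']
  refine le_trans (le_of_eq ?_) (abs_add_le _ _)
  congr 1
  ring

end Marginals

/-! ### Weights near a vertex and counting of spoiled vertices -/

section Sites

variable {V : Type*} [Fintype V]

open Classical in
/-- The weights that govern the vertex `v`, as indices: the edges at `v`, the vertex `v`, and its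
neighbours. -/
noncomputable def star (G : SimpleGraph V) (v : V) : Finset (G.edgeSet ⊕ V) :=
  (edgesAt G ∅ v).disjSum (insert v (Finset.univ.filter (G.Adj v)))

open Classical in
/-- The weights that govern the vertices of the list `l`. -/
noncomputable def sites (G : SimpleGraph V) (l : List V) : Finset (G.edgeSet ⊕ V) :=
  l.toFinset.biUnion (star G)

variable {G : SimpleGraph V}

theorem inl_mem_star {v : V} {f : G.edgeSet} : Sum.inl f ∈ star G v ↔ v ∈ (f : Sym2 V) := by
  simp [star, mem_edgesAt]

theorem inr_mem_star {u v : V} : Sum.inr u ∈ star G v ↔ u = v ∨ G.Adj v u := by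
  simp [star]

open Classical in
theorem card_edgesAt_le {D : ℕ} (hD : ∀ v, (Finset.univ.filter (G.Adj v)).card ≤ D) (v : V) :
    (edgesAt G ∅ v).card ≤ D := by
  have hsub : edgesAt G ∅ v ⊆ (Finset.univ.filter (G.Adj v)).attach.image
      fun u : {u // u ∈ Finset.univ.filter (G.Adj v)} =>
        ⟨s(v, (u : V)), (Finset.mem_filter.1 u.2).2⟩ := by
    intro f hf
    obtain ⟨f, hfE⟩ := f
    obtain ⟨u, rfl⟩ := Sym2.mem_iff_exists.1 (mem_edgesAt.1 hf).1
    exact Finset.mem_image.2 ⟨⟨u, Finset.mem_filter.2 ⟨Finset.mem_univ _, hfE⟩⟩,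
      Finset.mem_attach _ _, rfl⟩
  refine (Finset.card_le_card hsub).trans (Finset.card_image_le.trans ?_)
  rw [Finset.card_attach]
  exact hD v

open Classical in
theorem card_star_le {D : ℕ} (hD : ∀ v, (Finset.univ.filter (G.Adj v)).card ≤ D) (v : V) :
    (star G v).card ≤ 2 * D + 1 := by
  rw [star, Finset.card_disjSum]
  have h1 := card_edgesAt_le hD v
  have h2 := (Finset.card_insert_le v (Finset.univ.filter (G.Adj v))).trans
    (Nat.succ_le_succ (hD v))
  omega

open Classical in
theorem card_sites_le {D : ℕ} (hD : ∀ v, (Finset.univ.filter (G.Adj v)).card ≤ D) (l : List V) :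
    (sites G l).card ≤ l.length * (2 * D + 1) :=
  (Finset.card_biUnion_le_card_mul _ _ _ fun v _ => card_star_le hD v).trans
    (Nat.mul_le_mul_right _ l.toFinset_card_le)

open Classical in
theorem card_filter_mem_star_le {D : ℕ} (hD1 : 1 ≤ D)
    (hD : ∀ v, (Finset.univ.filter (G.Adj v)).card ≤ D) (s : G.edgeSet ⊕ V) :
    (Finset.univ.filter fun v => s ∈ star G v).card ≤ D + 1 := by
  rcases s with ⟨f, hf⟩ | u
  · induction f with
    | _ x y =>
      -- An edge weight lies in the stars of its two ends only, and 2 ≤ D + 1 because D ≥ 1.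
      have : (Finset.univ.filter fun v => Sum.inl ⟨s(x, y), hf⟩ ∈ star G v) ⊆ {x, y} := by
        intro v hv
        simpa [inl_mem_star] using hv
      exact (Finset.card_le_card this).trans (Finset.card_le_two.trans (by omega))
  · have : (Finset.univ.filter fun v => Sum.inr u ∈ star G v) ⊆
        insert u (Finset.univ.filter (G.Adj u)) := by
      intro v hv
      simp only [inr_mem_star, Finset.mem_filter, Finset.mem_univ, true_and] at hv
      simpa [G.adj_comm, eq_comm] using hv
    exact (Finset.card_le_card this).trans ((Finset.card_insert_le _ _).trans
      (Nat.succ_le_succ (hD u)))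

-- Each index in B spoils at most D + 1 vertices, namely those whose star contains it.
open Classical in
theorem length_le_countP_add {D : ℕ} (hD1 : 1 ≤ D)
    (hD : ∀ v, (Finset.univ.filter (G.Adj v)).card ≤ D) (B : Finset (G.edgeSet ⊕ V))
    {l : List V} (hl : l.Nodup) :
    l.length ≤ l.countP (fun v => decide (∀ s ∈ star G v, s ∉ B)) +
      (sites G l ∩ B).card * (D + 1) := by
  rw [List.length_eq_countP_add_countP (fun v => decide (∀ s ∈ star G v, s ∉ B)) (l := l)]
  refine Nat.add_le_add_left ?_ _
  rw [List.countP_eq_length_filter, ← List.toFinset_card_of_nodup (hl.filter _)]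
  refine le_trans (Finset.card_le_card ?_) (Finset.card_biUnion_le_card_mul _
    (fun s => Finset.univ.filter fun v => s ∈ star G v) _
    fun s _ => card_filter_mem_star_le hD1 hD s)
  intro v hv
  simp only [List.mem_toFinset, List.mem_filter, decide_eq_true_eq, not_forall,
    not_not] at hv
  obtain ⟨hvl, s, hs, hsB⟩ := hv
  simp only [Finset.mem_biUnion, Finset.mem_inter, Finset.mem_filter, Finset.mem_univ, true_and,
    sites, List.mem_toFinset]
  exact ⟨s, ⟨⟨v, hvl, hs⟩, hsB⟩, hs⟩

open Classical in
/-- The indices of the weights at the edge `e` itself and at its end vertices. -/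
noncomputable def rootSites (e : G.edgeSet) : Finset (G.edgeSet ⊕ V) :=
  Finset.disjSum {e} (Finset.univ.filter fun v => v ∈ (e : Sym2 V))

theorem card_rootSites_le (e : G.edgeSet) : (rootSites e).card ≤ 3 := by
  classical
  obtain ⟨e, he⟩ := e
  induction e with
  | _ x y =>
    have : (Finset.univ.filter fun v => v ∈ s(x, y)) ⊆ {x, y} := by
      intro v hv
      simpa using hv
    have h2 := (Finset.card_le_card this).trans Finset.card_le_two
    rw [rootSites, Finset.card_disjSum, Finset.card_singleton]
    change 1 + (Finset.univ.filter fun v => v ∈ s(x, y)).card ≤ 3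
    omega

end Sites

/-! ### The ball around the edge and the deterministic decay estimate -/

section Ball

variable {V : Type*} {G : SimpleGraph V}

/-- `v` is joined to an end vertex of `e` by a walk of length at most `j`. -/
def Near (e : G.edgeSet) (j : ℕ) (v : V) : Prop :=
  ∃ z ∈ (e : Sym2 V), ∃ p : G.Walk z v, p.length ≤ j

theorem Near.succ {e : G.edgeSet} {j : ℕ} {v u : V} (hv : Near e j v) (h : G.Adj v u) :
    Near e (j + 1) u := by
  obtain ⟨z, hz, p, hp⟩ := hv
  exact ⟨z, hz, p.concat h, by simpa using hp⟩

theorem Near.mem_edgeBall {e : G.edgeSet} {j : ℕ} {v : V} (hv : Near e j v) {R : ℝ}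
    (hR : (j : ℝ) ≤ R) : v ∈ (edgeBall G e R).verts := by
  obtain ⟨z, hz, p, hp⟩ := hv
  refine ⟨z, hz, p.reachable, le_trans ?_ hR⟩
  exact_mod_cast (SimpleGraph.dist_le p).trans hp

theorem Near.edge_mem_edgeBall {e : G.edgeSet} {j : ℕ} {v : V} (hv : Near e j v) {R : ℝ}
    (hR : (j : ℝ) + 1 ≤ R) {f : G.edgeSet} (hf : v ∈ (f : Sym2 V)) :
    (f : Sym2 V) ∈ (edgeBall G e R).edgeSet := by
  obtain ⟨f, hfE⟩ := f
  obtain ⟨u, rfl⟩ := Sym2.mem_iff_exists.1 hf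
  have hadj : G.Adj v u := hfE
  have hu := (hv.succ hadj).mem_edgeBall (R := R) (by exact_mod_cast hR)
  have hv' := hv.mem_edgeBall (R := R) (by linarith)
  rw [SimpleGraph.Subgraph.mem_edgeSet]
  exact ⟨hv', hu, hadj⟩

variable [Fintype V]

theorem sum_activity_le {D : ℕ}
    (hD : ∀ v, (edgesAt G ∅ v).card ≤ D) {w : G.edgeSet → ℝ} {ν : V → ℝ} {t : ℝ} {v : V}
    (hv : ∀ s ∈ star G v, |Sum.elim w ν s| ≤ t) (H : G.Subgraph) :
    ∑ f ∈ edgesAt G ∅ v, activity H w ν f ≤ D * Real.exp (3 * t) := by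
  classical
  -- The factor 3 counts one edge weight and two vertex weights, each at most t in absolute value.
  have hle : ∀ f ∈ edgesAt G ∅ v, activity H w ν f ≤ Real.exp (3 * t) := by
    intro f hf
    rw [activity]
    split_ifs
    · rw [Real.exp_le_exp]
      have hvf := (mem_edgesAt.1 hf).1
      have h1 := abs_le.1 (hv (Sum.inl f) (inl_mem_star.2 hvf))
      obtain ⟨f, hfE⟩ := f
      obtain ⟨u, rfl⟩ := Sym2.mem_iff_exists.1 hvf
      have hadj : G.Adj v u := hfE
      have h2 := abs_le.1 (hv (Sum.inr v) (inr_mem_star.2 (Or.inl rfl)))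
      have h3 := abs_le.1 (hv (Sum.inr u) (inr_mem_star.2 (Or.inr hadj)))
      have h4 : (Finset.univ.filter fun x => x ∈ s(v, u)) = {v, u} := by
        ext z
        simp
      simp only [Sum.elim_inl, Sum.elim_inr] at h1 h2 h3
      simp only [h4, Finset.sum_pair hadj.ne]
      linarith
    · positivity
  refine (Finset.sum_le_card_nsmul _ _ _ hle).trans ?_
  rw [nsmul_eq_mul]
  exact mul_le_mul_of_nonneg_right (by exact_mod_cast hD v) (Real.exp_pos _).le

open Classical in
theorem abs_edgeMarginal_sub_le_pow {D : ℕ} (hD1 : 1 ≤ D)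
    (hD : ∀ v, (Finset.univ.filter (G.Adj v)).card ≤ D) {w : G.edgeSet → ℝ} {ν : V → ℝ} {t : ℝ}
    (e : G.edgeSet) {R : ℝ} {n q : ℕ} (hn : n + 1 = 2 * (D + 1) * q) (hR : (n : ℝ) + 1 ≤ R)
    (hq : 3 ≤ q)
    (hbad : ∀ z ∈ (e : Sym2 V), ∀ l ∈ walksFrom G n z, l.Nodup →
      ((sites G l \ rootSites e).filter fun s => t ≤ |Sum.elim w ν s|).card < q)
    {H : G.Subgraph} (hH : edgeBall G e R ≤ H) :
    |edgeMarginal ⊤ w ν e - edgeMarginal H w ν e| ≤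
      2 * ((D * Real.exp (3 * t) / (1 + D * Real.exp (3 * t))) ^ (q - 3) *
        Real.log (1 + D * Real.exp (3 * t))) := by
  set B : Finset (G.edgeSet ⊕ V) :=
    Finset.univ.filter (fun s => t ≤ |Sum.elim w ν s|) ∪ rootSites e with hB
  have hcount : ∀ z ∈ (e : Sym2 V), ∀ l ∈ walksFrom G n z, l.Nodup →
      q - 3 + 1 ≤ l.countP (fun v => decide (∀ s ∈ star G v, s ∉ B)) := by
    intro z hz l hl hnd
    have h1 := length_le_countP_add hD1 hD B hnd
    -- At most q - 1 large weights away from e, plus at most 3 root sites.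
    have h2 : (sites G l ∩ B).card ≤ q + 2 := by
      have hsub : sites G l ∩ B ⊆
          ((sites G l \ rootSites e).filter fun s => t ≤ |Sum.elim w ν s|) ∪ rootSites e := by
        intro s hs
        simp only [hB, Finset.mem_inter, Finset.mem_union, Finset.mem_filter, Finset.mem_univ,
          true_and, Finset.mem_sdiff] at hs ⊢
        tauto
      have h3 := (Finset.card_le_card hsub).trans (Finset.card_union_le _ _)
      have h4 := hbad z hz l hl hnd
      have h5 := card_rootSites_le e
      omega
    -- The walk has 2(D+1)q vertices, of which at most (q+2)(D+1) are spoiled; at least (q-2)(D+1) ≥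
    -- (q-3) + 1 remain good.
    have h3 := Nat.mul_le_mul_right (D + 1) h2
    rw [length_of_mem_walksFrom hl, hn] at h1
    obtain ⟨r, rfl⟩ := Nat.exists_eq_add_of_le hq
    rw [Nat.add_sub_cancel_left]
    have h4 : r + 1 ≤ (r + 1) * (D + 1) := Nat.le_mul_of_pos_right _ D.succ_pos
    nlinarith
  have hab : ∀ j ≤ n, ∀ v, Near e j v → ∀ f : G.edgeSet, v ∈ (f : Sym2 V) →
      activity ⊤ w ν f = activity H w ν f := by
    intro j hj v hv f hf
    have h1 := hv.edge_mem_edgeBall (R := R) (by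
      have : (j : ℝ) ≤ n := by exact_mod_cast hj
      linarith) hf
    have h2 : (f : Sym2 V) ∈ H.edgeSet := SimpleGraph.Subgraph.edgeSet_mono hH h1
    simp [activity, h2]
  have hgood : ∀ j ≤ n, ∀ v, Near e j v → decide (∀ s ∈ star G v, s ∉ B) = true →
      ∑ f ∈ edgesAt G ∅ v, activity ⊤ w ν f ≤ D * Real.exp (3 * t) := by
    intro j _ v _ hv
    refine sum_activity_le (card_edgesAt_le hD) (fun s hs => ?_) _
    have := of_decide_eq_true hv s hs
    simp only [hB, Finset.mem_union, Finset.mem_filter, Finset.mem_univ, true_and, not_or,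
      not_le] at this
    exact this.1.le
  have hroot : ∀ z ∈ (e : Sym2 V), ∀ X : Set V, z ∉ X →
      |Real.log (freeProb (activity ⊤ w ν) X z) - Real.log (freeProb (activity H w ν) X z)| ≤
        (D * Real.exp (3 * t) / (1 + D * Real.exp (3 * t))) ^ (q - 3) *
          Real.log (1 + D * Real.exp (3 * t)) := fun z hz X hzX =>
    abs_log_freeProb_sub_le_pow (activity_nonneg _ _ _) (activity_nonneg _ _ _) (by positivity)
      (fun _ _ _ h => h.succ) hab (fun v => decide (∀ s ∈ star G v, s ∉ B)) hgood n 0 (q - 3)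
      (by omega) X z hzX ⟨z, hz, .nil, le_rfl⟩ fun l hl hnd _ => hcount z hz l hl hnd
  have hball : (e : Sym2 V) ∈ H.edgeSet := by
    obtain ⟨z, hz⟩ : ∃ z, z ∈ (e : Sym2 V) := ⟨_, Sym2.out_fst_mem _⟩
    exact SimpleGraph.Subgraph.edgeSet_mono hH
      (Near.edge_mem_edgeBall (j := 0) ⟨z, hz, .nil, le_rfl⟩
        (by push_cast; linarith [Nat.cast_nonneg (α := ℝ) n]) hz)
  obtain ⟨e, he⟩ := e
  induction e with
  | _ x y =>
    have hadj : G.Adj x y := he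
    refine (abs_edgeMarginal_sub_le he (by simpa using hadj) hball).trans ?_
    rw [two_mul]
    exact add_le_add (hroot x (by simp) _ (by simp)) (hroot y (by simp) _ (by simpa using hadj.ne'))

end Ball

/-! ### The exceptional event: probability and measurability -/

section Probability

variable {V : Type*} {G : SimpleGraph V} {Ω : Type*} [MeasurableSpace Ω] {P : Measure Ω}

/-- The event that all the weights with index in `T` are at least `t` in absolute value. -/
def largeOn (W : DisorderedWeights G P) (t : ℝ) (T : Finset (G.edgeSet ⊕ V)) : Set Ω :=
  ⋂ s ∈ T, Sum.elim W.edge W.vertex s ⁻¹' {r | t ≤ |r|}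

theorem measurableSet_le_abs (t : ℝ) : MeasurableSet {r : ℝ | t ≤ |r|} :=
  measurableSet_le measurable_const continuous_abs.measurable

theorem measureReal_largeOn_le [IsProbabilityMeasure P] {φ : ℝ → ℝ} (W : DisorderedWeights G P)
    (he : ∀ e, IsPhiBounded φ (W.edge e) P) (hv : ∀ x, IsPhiBounded φ (W.vertex x) P) {t : ℝ}
    (ht : 0 < t) (T : Finset (G.edgeSet ⊕ V)) : P.real (largeOn W t T) ≤ φ t ^ T.card := by
  rw [largeOn, measureReal_def,
    W.indep.measure_inter_preimage_eq_mul T fun _ _ => measurableSet_le_abs t,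
    ENNReal.toReal_prod]
  rw [← Finset.prod_const]
  refine Finset.prod_le_prod (fun _ _ => ENNReal.toReal_nonneg) fun s _ => ?_
  rcases s with f | x
  · exact he f t ht
  · exact hv x t ht

theorem measurableSet_largeOn (W : DisorderedWeights G P) (t : ℝ) {T : Finset (G.edgeSet ⊕ V)}
    {U : Set V} {F : Set G.edgeSet} (hF : ∀ f, Sum.inl f ∈ T → f ∈ F)
    (hU : ∀ x, Sum.inr x ∈ T → x ∈ U) : MeasurableSet[W.sigma U F] (largeOn W t T) := by
  refine Finset.measurableSet_biInter _ fun s hs => ?_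
  rcases s with f | x
  · refine (le_sup_of_le_right (le_iSup₂_of_le f (hF f hs) le_rfl) :
      MeasurableSpace.comap (W.edge f) inferInstance ≤ W.sigma U F) _ ?_
    exact ⟨_, measurableSet_le_abs t, rfl⟩
  · refine (le_sup_of_le_left (le_iSup₂_of_le x (hU x hs) le_rfl) :
      MeasurableSpace.comap (W.vertex x) inferInstance ≤ W.sigma U F) _ ?_
    exact ⟨_, measurableSet_le_abs t, rfl⟩

variable [Fintype V]

open Classical in
/-- The event that some self-avoiding walk of length `n` from an end of `e` meets at least `q`
large weights, not counting those at `e`. -/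
noncomputable def badEvent (W : DisorderedWeights G P) (e : G.edgeSet) (t : ℝ) (n q : ℕ) : Set Ω :=
  ⋃ z ∈ Finset.univ.filter fun z => z ∈ (e : Sym2 V),
    ⋃ l ∈ (walksFrom G n z).filter fun l => l.Nodup,
      ⋃ T ∈ (sites G l \ rootSites e).powersetCard q, largeOn W t T

-- Union bound: two ends of e, at most D^n walks from each, at most 2^((n+1)(2D+1)) subsets of the
-- sites of a walk, and probability at most φ(t)^q for each subset of size q.
open Classical in
theorem measureReal_badEvent_le [IsProbabilityMeasure P] {φ : ℝ → ℝ} (W : DisorderedWeights G P)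
    (he : ∀ e, IsPhiBounded φ (W.edge e) P) (hv : ∀ x, IsPhiBounded φ (W.vertex x) P) {t : ℝ}
    (ht : 0 < t) (hφ : 0 < φ t) {D : ℕ} (hD : ∀ v, (Finset.univ.filter (G.Adj v)).card ≤ D)
    (e : G.edgeSet) (n q : ℕ) :
    P.real (badEvent W e t n q) ≤ 2 * (D ^ n * (2 ^ ((n + 1) * (2 * D + 1)) * φ t ^ q)) := by
  have hpath : ∀ n (z : V), ∀ l ∈ (walksFrom G n z).filter (fun l => l.Nodup),
      P.real (⋃ T ∈ (sites G l \ rootSites e).powersetCard q, largeOn W t T) ≤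
        2 ^ ((n + 1) * (2 * D + 1)) * φ t ^ q := by
    intro n z l hl
    refine (measureReal_biUnion_finset_le _ _).trans ?_
    refine (Finset.sum_le_card_nsmul _ _ (φ t ^ q) fun T hT => ?_).trans ?_
    · rw [← (Finset.mem_powersetCard.1 hT).2]
      exact measureReal_largeOn_le W he hv ht T
    · rw [nsmul_eq_mul]
      refine mul_le_mul_of_nonneg_right ?_ (by positivity)
      have h1 : ((sites G l \ rootSites e).powersetCard q).card ≤
          2 ^ ((n + 1) * (2 * D + 1)) := by
        rw [Finset.card_powersetCard]
        refine (Nat.choose_le_two_pow _ _).trans (Nat.pow_le_pow_right (by norm_num) ?_)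
        refine (Finset.card_le_card Finset.sdiff_subset).trans ?_
        rw [← length_of_mem_walksFrom (Finset.mem_filter.1 hl).1]
        exact card_sites_le hD l
      exact_mod_cast h1
  have hpos : 0 ≤ 2 ^ ((n + 1) * (2 * D + 1)) * φ t ^ q := by positivity
  have hroot : ∀ z ∈ Finset.univ.filter (fun z => z ∈ (e : Sym2 V)),
      P.real (⋃ l ∈ (walksFrom G n z).filter fun l => l.Nodup,
        ⋃ T ∈ (sites G l \ rootSites e).powersetCard q, largeOn W t T) ≤
        D ^ n * (2 ^ ((n + 1) * (2 * D + 1)) * φ t ^ q) := by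
    intro z _
    refine (measureReal_biUnion_finset_le _ _).trans ?_
    refine (Finset.sum_le_card_nsmul _ _ _ (hpath n z)).trans ?_
    rw [nsmul_eq_mul]
    refine mul_le_mul_of_nonneg_right ?_ hpos
    exact_mod_cast (Finset.card_le_card (Finset.filter_subset _ _)).trans
      (card_walksFrom_le hD n z)
  refine (measureReal_biUnion_finset_le _ _).trans ?_
  refine (Finset.sum_le_card_nsmul _ _ _ hroot).trans ?_
  rw [nsmul_eq_mul]
  refine mul_le_mul_of_nonneg_right ?_ (by positivity)
  have h1 : (Finset.univ.filter fun z => z ∈ (e : Sym2 V)).card ≤ 2 := by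
    obtain ⟨e, he'⟩ := e
    induction e with
    | _ x y =>
      have : (Finset.univ.filter fun v => v ∈ s(x, y)) ⊆ {x, y} := by
        intro v hv
        simpa using hv
      exact (Finset.card_le_card this).trans Finset.card_le_two
  exact_mod_cast h1

/-- The walks stay within distance n of e, so their stars stay within n + 1 ≤ R; the root sites were
removed from the count. -/
theorem measurableSet_badEvent (W : DisorderedWeights G P) (e : G.edgeSet) (t : ℝ) {n : ℕ} (q : ℕ)
    {R : ℝ} (hR : (n : ℝ) + 1 ≤ R) :
    MeasurableSet[W.sigma ((edgeBall G e R).verts \ {x | x ∈ (e : Sym2 V)})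
      ({f | (f : Sym2 V) ∈ (edgeBall G e R).edgeSet} \ {e})] (badEvent W e t n q) := by
  classical
  refine Finset.measurableSet_biUnion _ fun z hz => Finset.measurableSet_biUnion _ fun l hl =>
    Finset.measurableSet_biUnion _ fun T hT => ?_
  have hsub := (Finset.mem_powersetCard.1 hT).1
  have hnear : ∀ v ∈ l, Near e n v := by
    intro v hv
    obtain ⟨p, hp⟩ := exists_walk_of_mem_walksFrom (Finset.mem_filter.1 hl).1 hv
    exact ⟨z, (Finset.mem_filter.1 hz).2, p, hp⟩
  have hsites : ∀ s ∈ T, (∃ v ∈ l, s ∈ star G v) ∧ s ∉ rootSites e := by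
    intro s hs
    simpa [sites] using hsub hs
  refine measurableSet_largeOn W t (fun f hf => ?_) fun x hx => ?_
  · obtain ⟨⟨v, hv, hfv⟩, hr⟩ := hsites _ hf
    refine ⟨(hnear v hv).edge_mem_edgeBall hR (inl_mem_star.1 hfv), ?_⟩
    simpa [rootSites] using hr
  · obtain ⟨⟨v, hv, hxv⟩, hr⟩ := hsites _ hx
    refine ⟨?_, by simpa [rootSites] using hr⟩
    rcases inr_mem_star.1 hxv with rfl | hadj
    · exact (hnear x hv).mem_edgeBall (by linarith)
    · exact ((hnear v hv).succ hadj).mem_edgeBall (by exact_mod_cast hR)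

open Classical in
theorem card_large_lt_of_notMem_badEvent {W : DisorderedWeights G P} {e : G.edgeSet} {t : ℝ}
    {n q : ℕ} {ω : Ω} (hω : ω ∉ badEvent W e t n q) {z : V} (hz : z ∈ (e : Sym2 V)) {l : List V}
    (hl : l ∈ walksFrom G n z) (hnd : l.Nodup) :
    ((sites G l \ rootSites e).filter fun s =>
      t ≤ |Sum.elim (fun f => W.edge f ω) (fun x => W.vertex x ω) s|).card < q := by
  by_contra! hcon
  obtain ⟨T, hT, hcard⟩ := Finset.exists_subset_card_eq hcon
  refine hω ?_
  simp only [badEvent, Set.mem_iUnion]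
  refine ⟨z, by simpa using hz, l, Finset.mem_filter.2 ⟨hl, hnd⟩, T,
    Finset.mem_powersetCard.2 ⟨hT.trans (Finset.filter_subset _ _), hcard⟩, ?_⟩
  simp only [largeOn, Set.mem_iInter]
  intro s hs
  have := (Finset.mem_filter.1 (hT hs)).2
  rcases s with f | x <;> exact this

end Probability

/-! ### Choice of constants and conclusion -/

theorem IsVanishing.exists_pos_le {φ : ℝ → ℝ} (hφ : IsVanishing φ) {η : ℝ} (hη : 0 < η) :
    ∃ t : ℝ, 0 < t ∧ φ t ≤ η :=
  ((eventually_gt_atTop 0).and (hφ.2.eventually (ge_mem_nhds hη))).exists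

end MonomerDimer

theorem mainTheorem5 (φ : ℝ → ℝ) (hφ : MonomerDimer.IsVanishing φ) (D : ℕ) (hD : 1 ≤ D) :
    ∃ c C : ℝ, 0 < c ∧ 0 < C ∧
      ∀ (V : Type*) [Fintype V] (G : SimpleGraph V) [DecidableRel G.Adj],
        G.maxDegree ≤ D →
        ∀ (Ω : Type*) [MeasurableSpace Ω] (P : Measure Ω) [IsProbabilityMeasure P]
          (W : MonomerDimer.DisorderedWeights G P),
          (∀ e, MonomerDimer.IsPhiBounded φ (W.edge e) P) →
          (∀ x, MonomerDimer.IsPhiBounded φ (W.vertex x) P) →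
          ∀ (e : G.edgeSet) (R : ℝ), 1 ≤ R →
            ∃ A : Set Ω,
              MeasurableSet[W.sigma
                ((MonomerDimer.edgeBall G e R).verts \ {x | x ∈ (e : Sym2 V)})
                ({f | (f : Sym2 V) ∈ (MonomerDimer.edgeBall G e R).edgeSet} \ {e})] A ∧
              1 - C * Real.exp (-c * R) ≤ P.real A ∧
              ∀ ω ∈ A, ∀ H : G.Subgraph, MonomerDimer.edgeBall G e R ≤ H →
                |MonomerDimer.edgeMarginal ⊤ (fun f => W.edge f ω) (fun x => W.vertex x ω) e -
                    MonomerDimer.edgeMarginal H (fun f => W.edge f ω) (fun x => W.vertex x ω) e|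
                  ≤ C * Real.exp (-c * R) := by
  classical
  set L : ℕ := 2 * (D + 1) with hL
  have hLpos : (0 : ℝ) < L := by rw [hL]; positivity
  have hDpos : (0 : ℝ) < D := by exact_mod_cast hD
  -- This threshold makes D^L · 2^(L(2D+1)) · φ(t) ≤ 1/2, so with n + 1 = Lq the union bound is at
  -- most 2 · (1/2)^q.
  obtain ⟨t, ht, hφt⟩ := hφ.exists_pos_le
    (η := 1 / (2 * (D ^ L * 2 ^ (L * (2 * D + 1))))) (by positivity)
  have hφpos := hφ.1 t ht
  set K : ℝ := D * Real.exp (3 * t) with hK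
  have hKpos : 0 < K := by positivity
  set B : ℝ := Real.log (1 + K)
  have hB : 0 ≤ B := Real.log_nonneg (by linarith)
  -- One rate for both errors: K / (1 + K) from the contraction, 1/2 from the union bound.
  set ρ : ℝ := max (K / (1 + K)) (1 / 2) with hρ
  have hρ0 : 0 < ρ := lt_max_of_lt_right (by norm_num)
  have hρ1 : ρ < 1 := max_lt (by rw [div_lt_one] <;> linarith) (by norm_num)
  have hlog : Real.log ρ < 0 := Real.log_neg hρ0 hρ1
  -- Here exp(-cR) = ρ^(R/L) ≥ ρ^(q+1) for q = ⌊R/L⌋, while the estimates give ρ^(q-3); the factor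
  -- ρ^(-4) pays the difference. The term 2B serves the marginals and 2 the probability.
  refine ⟨-Real.log ρ / L, (2 * B + 2) / ρ ^ 4, div_pos (by linarith) hLpos, by positivity, ?_⟩
  intro V _ G _ hG Ω _ P _ W he hv e R hR
  have hdeg : ∀ v, (@Finset.filter V (G.Adj v) (fun _ => Classical.propDecidable _)
      Finset.univ).card ≤ D := by
    intro v
    refine le_trans (le_of_eq ?_) ((G.degree_le_maxDegree v).trans hG)
    rw [← SimpleGraph.card_neighborFinset_eq_degree]
    congr 1
    ext u
    simp
  set q : ℕ := ⌊R / L⌋₊ with hq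
  have hqR : (q : ℝ) ≤ R / L := Nat.floor_le (by positivity)
  have hRq : R / L < q + 1 := Nat.lt_floor_add_one _
  have hexp : (2 * B + 2) / ρ ^ 4 * ρ ^ (q + 1) ≤
      (2 * B + 2) / ρ ^ 4 * Real.exp (-(-Real.log ρ / L) * R) := by
    refine mul_le_mul_of_nonneg_left ?_ (by positivity)
    rw [← Real.rpow_natCast, Real.rpow_def_of_pos hρ0, Real.exp_le_exp]
    have : -(-Real.log ρ / L) * R = Real.log ρ * (R / L) := by ring
    rw [this]
    push_cast
    exact mul_le_mul_of_nonpos_left hRq.le hlog.le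
  rcases lt_or_ge q 3 with hq3 | hq3
  -- For small R the bound C exp(-cR) is at least 2B + 2 ≥ 1, so the empty event suffices.
  · refine ⟨∅, @MeasurableSet.empty Ω (W.sigma _ _), ?_, by simp⟩
    have h1 : ρ ^ 4 ≤ ρ ^ (q + 1) := pow_le_pow_of_le_one hρ0.le hρ1.le (by omega)
    have h2 : 2 * B + 2 ≤ (2 * B + 2) / ρ ^ 4 * ρ ^ (q + 1) := by
      rw [div_mul_eq_mul_div, le_div_iff₀ (by positivity)]
      exact mul_le_mul_of_nonneg_left h1 (by positivity)
    rw [measureReal_empty]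
    linarith
  · obtain ⟨n, hn⟩ : ∃ n, n + 1 = L * q :=
      ⟨L * q - 1, Nat.sub_add_cancel (Nat.mul_pos (by omega) (by omega))⟩
    have hnR : (n : ℝ) + 1 ≤ R := by
      have h1 : (n : ℝ) + 1 = L * q := by exact_mod_cast hn
      rw [h1, mul_comm]
      exact (le_div_iff₀ hLpos).1 hqR
    have hsplit : (2 * B + 2) / ρ ^ 4 * ρ ^ (q + 1) = (2 * B + 2) * ρ ^ (q - 3) := by
      rw [show q + 1 = (q - 3) + 4 by omega, pow_add]
      field_simp
    rw [hsplit] at hexp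
    have hmeas := MonomerDimer.measurableSet_badEvent W e t q hnR
    refine ⟨(MonomerDimer.badEvent W e t n q)ᶜ, hmeas.compl, ?_, ?_⟩
    · have hle : W.sigma ((MonomerDimer.edgeBall G e R).verts \ {x | x ∈ (e : Sym2 V)})
          ({f | (f : Sym2 V) ∈ (MonomerDimer.edgeBall G e R).edgeSet} \ {e}) ≤ ‹_› :=
        sup_le (iSup₂_le fun x _ => (W.measurable_vertex x).comap_le)
          (iSup₂_le fun f _ => (W.measurable_edge f).comap_le)
      rw [probReal_compl_eq_one_sub (hle _ hmeas)]
      have hbad := MonomerDimer.measureReal_badEvent_le W he hv ht hφpos hdeg e n q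
      have h1 : (D : ℝ) ^ n * (2 ^ ((n + 1) * (2 * D + 1)) * φ t ^ q) ≤ (1 / 2) ^ q := by
        calc (D : ℝ) ^ n * (2 ^ ((n + 1) * (2 * D + 1)) * φ t ^ q)
            ≤ D ^ (L * q) * (2 ^ (L * q * (2 * D + 1)) * φ t ^ q) := by
              rw [← hn]
              refine mul_le_mul_of_nonneg_right ?_ (by positivity)
              exact pow_le_pow_right₀ (by exact_mod_cast hD) n.le_succ
          _ = (D ^ L * 2 ^ (L * (2 * D + 1)) * φ t) ^ q := by
              rw [mul_pow, mul_pow, ← pow_mul, ← pow_mul, mul_right_comm L]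
              exact (mul_assoc _ _ _).symm
          _ ≤ (1 / 2) ^ q := by
              refine pow_le_pow_left₀ (by positivity) ?_ q
              rw [le_div_iff₀ (by positivity)] at hφt
              linarith
      have h2 : ((1 : ℝ) / 2) ^ q ≤ ρ ^ (q - 3) :=
        (pow_le_pow_of_le_one (by norm_num) (by norm_num) (Nat.sub_le q 3)).trans
          (pow_le_pow_left₀ (by norm_num) (le_max_right _ _) _)
      have h3 : 0 ≤ B * ρ ^ (q - 3) := by positivity
      linarith
    · intro ω hω H hH
      refine (MonomerDimer.abs_edgeMarginal_sub_le_pow hD hdeg e hn hnR hq3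
        (fun z hz l hl hnd => MonomerDimer.card_large_lt_of_notMem_badEvent hω hz hl hnd)
        hH).trans (le_trans ?_ hexp)
      have h1 : (K / (1 + K)) ^ (q - 3) ≤ ρ ^ (q - 3) :=
        pow_le_pow_left₀ (by positivity) (le_max_left _ _) _
      have h2 := mul_le_mul_of_nonneg_right h1 hB
      have h3 : 0 ≤ ρ ^ (q - 3) := by positivity
      linarith
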